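/- **Setting.** We work in the synchronous $\mathcal{LOCAL}$ model: the nodes of a simple undirected $n$-vertex graph $G=(V,E)$ have distinct integer IDs, know $n$ and the IDs of their neighbours, hold independent private random seeds, and in each round exchange messages of unrestricted size with their neighbours; local computation is free. For a labelling $f:V\to L$, its *clusters* are the connected components of the graph formed by the edges of $G$ whose endpoints have equal labels. The *auxiliary graph* of a partition into clusters joins two distinct clusters when some edge of $G$ connects them. The labelling $f$ is a *weak-diameter $(d,K)$-network decomposition* if the auxiliary graph of its clusters has chromatic number at most $K$ and any two vertices of the same cluster are at distance at most $d$ in $G$. A family $(S(v))_{v\in V}$ of nonempty sets of labels is a *generic solution* if every selection $f(v)\in S(v)$, $v\in V$, gives a valid solution, no matter which selections the other vertices make. The *problem domain* is the set $L$ of all labels, the *solution domain size* is $\min_v|S(v)|$, and the *contingency factor* is $|L|/\min_v|S(v)|$. **Linial–Saks algorithm** with $T$ phases of $B$ rounds each. In each phase every vertex $y$ that has no label yet draws a radius $r_y$ with $\Pr[r_y=j]=2^{-(j+1)}$ for $0\le j<B$ and $\Pr[r_y=B]=2^{-B}$, and broadcasts its ID to all vertices within distance $r_y$ in the subgraph induced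 by the vertices without a label. A vertex $v$ without a label takes the highest ID it hears (its own included), say that of $y$; if its distance to $y$ in that subgraph is strictly less than $r_y$, it takes the index of the phase as its label, and otherwise it goes on to the next phase. **Generic algorithm.** For $c\ge 1$, run $c$ independent copies of this algorithm in parallel, and let $S(v)=\{\langle i,C_i(v)\rangle : 1\le i\le c,\ C_i(v)\text{ defined}\}$, where $C_i(v)$ is the label of $v$ in the $i$-th copy. The set of labels is $L=\{1,\dots,c\}\times\{1,\dots,T\}$. **Theorem.** For every $k\in\mathbb N$ there are $a\in\mathbb N$ and $K>0$, depending only on $k$, such that the following holds for every $n\ge 2$, every $c\ge 1$, every graph $G$ on $n$ vertices and every assignment of distinct IDs, with $B=\lceil\log_2 n\rceil$ and $T=a\lceil\log_2 n\rceil$. 1. The generic algorithm uses at most $K\log^2 n$ rounds, and $|L|\le K\,c\log n$. 2. The label functions $C_1,\dots,C_c$ are independent, and each is distributed as the output of one execution of the Linial–Saks algorithm. 3. With probability at least $(1-n^{-k})^c\ge 1-c\,n^{-k}$, every vertex receives exactly $c$ labels; the sets $S(v)$ form a generic solution of the weak-diameter $(K\log n,\;K\,c\log n)$-network decomposition problem;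 the solution domain has size $c$; and the contingency factor is at most $K\log n$. -/

import Mathlib

open MeasureTheory

/-! ### The LOCAL model with private randomness -/

/-- A randomized synchronous message-passing algorithm. Every node starts with its own ID, the IDs of
its neighbours and a private random seed (seeds of different nodes are independent, with law
`seedLaw`). In each round every node sends a message of unrestricted size to each of its neighbours,
receives the messages sent to it (each together with the ID of its sender) and updates its state.
After `rounds` rounds every node computes its output from its state. Local computation is free. -/
structure LocalAlgorithm (Out : Type) where
  Seed : Type
  [seedSpace : MeasurableSpace Seed]
  seedLaw : Measure Seed
  [seedProb : IsProbabilityMeasure seedLaw]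
  State : Type
  Msg : Type
  init : (ident : ℕ) → (neighbours : Finset ℕ) → Seed → State
  send : State → (receiver : ℕ) → Msg
  step : State → (inbox : Multiset (ℕ × Msg)) → State
  rounds : ℕ
  out : State → Out

attribute [instance] LocalAlgorithm.seedSpace LocalAlgorithm.seedProb

namespace LocalAlgorithm

variable {Out Out' : Type}

/-- The states of all nodes after a given number of rounds, on the network `G` with IDs `ident`,
when the private seeds of the nodes are `ω`. -/
def run (A : LocalAlgorithm Out) {V : Type*} [Fintype V] (G : SimpleGraph V) [DecidableRel G.Adj]
    (ident : V → ℕ) (ω : V → A.Seed) : ℕ → V → A.State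
  | 0, v => A.init (ident v) ((G.neighborFinset v).image ident) (ω v)
  | t + 1, v => A.step (A.run G ident ω t v)
      ((G.neighborFinset v).val.map fun u => (ident u, A.send (A.run G ident ω t u) (ident v)))

/-- The outputs of all nodes. -/
def output (A : LocalAlgorithm Out) {V : Type*} [Fintype V] (G : SimpleGraph V) [DecidableRel G.Adj]
    (ident : V → ℕ) (ω : V → A.Seed) (v : V) : Out :=
  A.out (A.run G ident ω A.rounds v)

/-- The joint law of the independent private seeds of the nodes. -/
noncomputable def law (A : LocalAlgorithm Out) (V : Type*) [Fintype V] : Measure (V → A.Seed) :=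
  Measure.pi fun _ => A.seedLaw

/-- Run `c` copies of `A` simultaneously, with independent randomness: each node holds `c`
independent seeds, and every message is the tuple of the messages of the `c` copies. -/
noncomputable def parallel (A : LocalAlgorithm Out) (c : ℕ) : LocalAlgorithm (Fin c → Out) where
  Seed := Fin c → A.Seed
  seedLaw := Measure.pi fun _ => A.seedLaw
  State := Fin c → A.State
  Msg := Fin c → A.Msg
  init := fun x nbrs r i => A.init x nbrs (r i)
  send := fun s y i => A.send (s i) y
  step := fun s inbox i => A.step (s i) (inbox.map fun m => (m.1, m.2 i))
  rounds := A.rounds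
  out := fun s i => A.out (s i)

/-- Apply a local function to the output of every node. -/
def mapOut (A : LocalAlgorithm Out) (g : Out → Out') : LocalAlgorithm Out' :=
  { A with out := fun s => g (A.out s) }

end LocalAlgorithm

/-! ### The Linial–Saks algorithm -/

namespace LinialSaks

/-- The number of leading heads in `B` coin flips. For fair coins this is the truncated geometric law:
the value is `j` with probability `2 ^ (-(j + 1))` for `j < B`, and `B` with probability `2 ^ (-B)`. -/
def radius {B : ℕ} (coins : Fin B → Bool) : ℕ :=
  (Finset.univ.filter fun j : Fin B => ∀ i ≤ j, coins i = true).card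

/-- The state of a node. A token `(x, k)` in `heard` was issued in the current phase by the node with
ID `x` and may still travel `k` edges further. `label` is the index of the phase in which the
node joined a cluster (`none` as long as it has not joined one). -/
structure NodeState (T B : ℕ) where
  ident : ℕ
  coins : Fin T → Fin B → Bool
  clock : ℕ
  heard : Finset (ℕ × ℕ)
  label : Option (Fin T)

/-- The token that a node issues at the start of phase `t`: its ID and its radius. -/
def ownToken {T B : ℕ} (ident : ℕ) (coins : Fin T → Fin B → Bool) (t : ℕ) : Finset (ℕ × ℕ) :=
  if h : t < T then {(ident, radius (coins ⟨t, h⟩))} else ∅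

/-- The tokens of a message that can travel the edge on which the message arrived. -/
def relay (M : Finset (ℕ × ℕ)) : Finset (ℕ × ℕ) :=
  (M.filter fun p => 0 < p.2).image fun p => (p.1, p.2 - 1)

/-- A node joins the cluster of the highest ID that it heard if it is at distance strictly less
than the radius from the node with that ID. -/
def Joins (heard : Finset (ℕ × ℕ)) : Prop :=
  ∃ p ∈ heard, (∀ q ∈ heard, q.1 ≤ p.1) ∧ 0 < p.2

instance (heard : Finset (ℕ × ℕ)) : Decidable (Joins heard) := by
  unfold Joins; infer_instance

def init {T B : ℕ} (ident : ℕ) (coins : Fin T → Fin B → Bool) : NodeState T B :=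
  ⟨ident, coins, 0, ownToken ident coins 0, none⟩

/-- Nodes that already belong to a cluster are silent. -/
def send {T B : ℕ} (s : NodeState T B) : Finset (ℕ × ℕ) :=
  if s.label = none then s.heard else ∅

/-- One round. Phase `t` consists of the `B` rounds `t * B, …, t * B + B - 1`. -/
def step {T B : ℕ} (s : NodeState T B) (inbox : Multiset (ℕ × Finset (ℕ × ℕ))) : NodeState T B :=
  let heard := s.heard ∪ (inbox.map fun m => relay m.2).sup
  if s.label ≠ none then { s with clock := s.clock + 1 }
  else if (s.clock + 1) % B ≠ 0 then { s with clock := s.clock + 1, heard := heard }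
  else
    { s with
      clock := s.clock + 1
      heard := ownToken s.ident s.coins (s.clock / B + 1)
      label := if h : s.clock / B < T then
          (if Joins heard then some ⟨s.clock / B, h⟩ else none) else none }

end LinialSaks

/-- The Linial–Saks weak-diameter network decomposition algorithm with `T` phases and maximal radius
`B`. In every phase each node `y` that is not yet in a cluster draws a radius `r` from the geometric
law with parameter `1 / 2` truncated at `B` and broadcasts its ID to distance `r` in the graph induced
by the nodes that are not yet in a cluster. A node `v` selects the highest ID it hears; it gets the
index of the phase as its label if it is at distance strictly less than `r` from the selected node,
and otherwise goes on to the next phase. A node that never joins a cluster outputs `none`. -/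
noncomputable def linialSaks (T B : ℕ) : LocalAlgorithm (Option (Fin T)) where
  Seed := Fin T → Fin B → Bool
  seedLaw := Measure.pi fun _ => Measure.pi fun _ => (PMF.uniformOfFintype Bool).toMeasure
  State := LinialSaks.NodeState T B
  Msg := Finset (ℕ × ℕ)
  init := fun x _ coins => LinialSaks.init x coins
  send := fun s _ => LinialSaks.send s
  step := LinialSaks.step
  rounds := T * B
  out := fun s => s.label

/-- The set of labels `⟨i, C i⟩`, where `i` ranges over the copies that produced a label. -/
def tagged {c T : ℕ} (C : Fin c → Option (Fin T)) : Finset (Fin c × Fin T) :=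
  Finset.univ.filter fun x => C x.1 = some x.2

/-- `c` independent simultaneous executions of the Linial–Saks algorithm, the label of the `i`-th
execution being tagged with `i`. -/
noncomputable def genericLinialSaks (c T B : ℕ) : LocalAlgorithm (Finset (Fin c × Fin T)) :=
  ((linialSaks T B).parallel c).mapOut tagged

/-! ### Network decompositions -/

section Decomposition

variable {V L ι : Type*}

/-- The auxiliary graph of a partition of the vertices into clusters. -/
def clusterGraph (G : SimpleGraph V) (cluster : V → ι) : SimpleGraph ι :=
  SimpleGraph.fromRel fun a b => ∃ u v, G.Adj u v ∧ cluster u = a ∧ cluster v = b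

/-- Weak `(d, K)`-network decomposition: the auxiliary graph has chromatic number at most `K`, and any
two vertices of a cluster are at distance at most `d` in `G`. -/
structure IsWeakNetworkDecomposition (G : SimpleGraph V) (d K : ℕ) (cluster : V → ι) : Prop where
  chromatic : (clusterGraph G cluster).chromaticNumber ≤ (K : ℕ∞)
  weakDiam : ∀ u v, cluster u = cluster v → G.edist u v ≤ (d : ℕ∞)

/-- The edges of `G` whose endpoints have the same label. -/
def sameLabelGraph (G : SimpleGraph V) (f : V → L) : SimpleGraph V where
  Adj u v := G.Adj u v ∧ f u = f v
  symm := ⟨fun _ _ h => ⟨h.1.symm, h.2.symm⟩⟩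
  loopless := ⟨fun v h => G.loopless.irrefl v h.1⟩

/-- The clusters of a labelling: the connected components of the vertices with the same label. -/
def labelCluster (G : SimpleGraph V) (f : V → L) (v : V) : (sameLabelGraph G f).ConnectedComponent :=
  (sameLabelGraph G f).connectedComponentMk v

/-! ### Generic solutions of labelling problems -/

/-- Every vertex has a nonempty set of labels, and any selection of one label per vertex, independent
of the selections made by the other vertices, is a valid solution. -/
def IsGenericSolution (valid : (V → L) → Prop) (S : V → Finset L) : Prop :=
  (∀ v, (S v).Nonempty) ∧ ∀ f : V → L, (∀ v, f v ∈ S v) → valid f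

/-- The size of the solution domain: the minimal number of labels offered to a vertex. -/
noncomputable def solutionDomainSize (S : V → Finset L) : ℕ := ⨅ v, (S v).card

/-- The size of the problem domain divided by the size of the solution domain. -/
noncomputable def contingencyFactor [Fintype L] (S : V → Finset L) : ℝ :=
  (Fintype.card L : ℝ) / (solutionDomainSize S : ℝ)

end Decomposition

/-! Validity of every selection is deterministic. A label names a copy and a phase, so a connected
set of equal labels lies in one phase of one copy. If adjacent vertices `u`, `v` both join in a
phase and `u` follows `y`, then `y` is strictly closer to `u` than its radius, so `v` hears `y` too;
by symmetry both follow the same leader (`JoinsTo.ident_le`, `exists_common_leader`). Hence a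
cluster has weak diameter at most `2 * B`, and the `c * T` labels themselves colour the auxiliary
graph.

Randomness is needed only for every vertex to get a label in every copy. Fix a phase and a vertex
`v`, and let `D y` be the distance from `y` to `v`. Whether `y` reaches `v` depends only on the
coins of `y` below index `D y`; whether it reaches beyond `v` depends on one further coin. Flipping
that coin of the leader preserves the leader and turns failure into success, so failure is at most
as likely as success, apart from leaders at distance at least `B`. None can occur unless some vertex
has radius `B`, and with probability at least 1/4 no vertex does. Thus `v` joins with probability at
least 1/8 (`card_le_card_leader`).

The unlabelled set before a phase ignores the coins of that phase, so `v` survives `T` phases with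
probability at most `(7/8)^T` (`card_aliveSet_succ_le`), and a union bound over the vertices
finishes one copy. The copies use disjoint seeds, so their success probabilities multiply. As seeds
are uniform on a finite set, all estimates are counts. The link to the message-passing code is the
invariant `PhaseInv`. -/

/-! ### Parallel execution and independence of the copies -/

namespace LocalAlgorithm

variable {Out Out' : Type}

theorem parallel_run (A : LocalAlgorithm Out) (c : ℕ) {V : Type*} [Fintype V] (G : SimpleGraph V)
    [DecidableRel G.Adj] (ident : V → ℕ) (ω : V → (A.parallel c).Seed) (t : ℕ) (v : V) (i : Fin c) :
    (A.parallel c).run G ident ω t v i =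
      A.run G ident (fun u => (ω u : Fin c → A.Seed) i) t v := by
  induction t generalizing v with
  | zero => rfl
  | succ t ih =>
    exact congrArg₂ A.step (ih v) ((Multiset.map_map _ _ _).trans (Multiset.map_congr rfl
      fun u _ => congrArg (fun s => (ident u, A.send s (ident v))) (ih u)))

theorem mapOut_run (A : LocalAlgorithm Out) (g : Out → Out') {V : Type*} [Fintype V]
    (G : SimpleGraph V) [DecidableRel G.Adj] (ident : V → ℕ) (ω : V → (A.mapOut g).Seed) (t : ℕ)
    (v : V) : (A.mapOut g).run G ident ω t v = A.run G ident ω t v := by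
  induction t generalizing v with
  | zero => rfl
  | succ t ih =>
    exact congrArg₂ A.step (ih v) (Multiset.map_congr rfl
      fun u _ => congrArg (fun s => (ident u, A.send s (ident v))) (ih u))

theorem output_parallel (A : LocalAlgorithm Out) (c : ℕ) {V : Type*} [Fintype V]
    (G : SimpleGraph V) [DecidableRel G.Adj] (ident : V → ℕ) (ω : V → (A.parallel c).Seed) (v : V) :
    (A.parallel c).output G ident ω v =
      fun i => A.output G ident (fun u => (ω u : Fin c → A.Seed) i) v :=
  funext fun i => congrArg A.out (A.parallel_run c G ident ω A.rounds v i)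

theorem output_mapOut (A : LocalAlgorithm Out) (g : Out → Out') {V : Type*} [Fintype V]
    (G : SimpleGraph V) [DecidableRel G.Adj] (ident : V → ℕ) (ω : V → (A.mapOut g).Seed) (v : V) :
    (A.mapOut g).output G ident ω v = g (A.output G ident ω v) :=
  congrArg (fun s => g (A.out s)) (A.mapOut_run g G ident ω A.rounds v)

end LocalAlgorithm

/-- Exchanging the two index sets of a finite family of independent identically distributed
variables. -/
theorem map_swap_pi_pi {V I S : Type*} [Fintype V] [Fintype I] [Finite S] [MeasurableSpace S]
    [MeasurableSingletonClass S] (μ : Measure S) [IsProbabilityMeasure μ] :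
    (Measure.pi fun _ : V => Measure.pi fun _ : I => μ).map Function.swap =
      Measure.pi fun _ : I => Measure.pi fun _ : V => μ := by
  refine Measure.ext_of_singleton fun f => ?_
  rw [Measure.map_apply (measurable_of_finite _) (measurableSet_singleton _)]
  have : (Function.swap : (V → I → S) → I → V → S) ⁻¹' {f} = {Function.swap f} := by
    ext g
    simp only [Set.mem_preimage, Set.mem_singleton_iff]
    exact ⟨fun h => h ▸ rfl, fun h => h ▸ rfl⟩
  rw [this]
  simp only [Measure.pi_singleton, Function.swap]
  exact Finset.prod_comm

/-- Once the index sets are exchanged the event is a box, so its mass factors. -/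
theorem pi_pi_forall_slice {V I S : Type*} [Fintype V] [Fintype I] [Finite S] [MeasurableSpace S]
    [MeasurableSingletonClass S] (μ : Measure S) [IsProbabilityMeasure μ]
    (F : I → Set (V → S)) :
    (Measure.pi fun _ : V => Measure.pi fun _ : I => μ) {ω | ∀ i, (fun v => ω v i) ∈ F i} =
      ∏ i, (Measure.pi fun _ : V => μ) (F i) := by
  rw [← Measure.pi_pi, ← map_swap_pi_pi,
    Measure.map_apply (measurable_of_finite _) (Set.toFinite _).measurableSet]
  congr 1
  ext ω
  simp [Set.mem_pi, Function.swap]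

/-- Ensures that a generic output determines the labels of all copies, so an event about them is an
event about the individual seed slices. -/
theorem tagged_injective {c T : ℕ} :
    Function.Injective (tagged : (Fin c → Option (Fin T)) → Finset (Fin c × Fin T)) := by
  intro C D h
  funext i
  ext s
  have := congrArg (fun S => (i, s) ∈ S) h
  simpa [tagged] using this

theorem output_genericLinialSaks (c T B : ℕ) {V : Type*} [Fintype V] (G : SimpleGraph V)
    [DecidableRel G.Adj] (ident : V → ℕ) (ω : V → Fin c → Fin T → Fin B → Bool) (v : V) :
    (genericLinialSaks c T B).output G ident ω v =
      tagged fun i => (linialSaks T B).output G ident (fun u => ω u i) v := by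
  exact (LocalAlgorithm.output_mapOut ((linialSaks T B).parallel c) tagged G ident ω v).trans
    (congrArg tagged ((linialSaks T B).output_parallel c G ident ω v))

theorem law_genericLinialSaks_slices (c T B : ℕ) {V : Type*} [Fintype V]
    (F : Fin c → Set (V → Fin T → Fin B → Bool)) :
    (genericLinialSaks c T B).law V
        {ω : V → Fin c → Fin T → Fin B → Bool | ∀ i, (fun v => ω v i) ∈ F i} =
      ∏ i, (linialSaks T B).law V (F i) :=
  pi_pi_forall_slice (Measure.pi fun _ : Fin T => Measure.pi fun _ : Fin B =>
    (PMF.uniformOfFintype Bool).toMeasure) F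

theorem law_genericLinialSaks_output (c T B : ℕ) {V : Type*} [Fintype V] (G : SimpleGraph V)
    [DecidableRel G.Adj] (ident : V → ℕ) (E : Fin c → Set (V → Option (Fin T))) :
    (genericLinialSaks c T B).law V
        {ω | ∃ C : Fin c → V → Option (Fin T), (∀ i, C i ∈ E i) ∧
          ∀ v, (genericLinialSaks c T B).output G ident ω v = tagged fun i => C i v} =
      ∏ i, (linialSaks T B).law V {ω | (linialSaks T B).output G ident ω ∈ E i} := by
  refine (congrArg _ ?_).trans (law_genericLinialSaks_slices c T B fun i =>
    {ω | (linialSaks T B).output G ident ω ∈ E i})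
  ext ω
  constructor
  · rintro ⟨C, hC, h⟩ i
    have : C i = (linialSaks T B).output G ident fun u => ω u i := by
      funext v
      have h1 := tagged_injective ((output_genericLinialSaks c T B G ident ω v).symm.trans (h v))
      exact (congrFun h1 i).symm
    change (linialSaks T B).output G ident (fun u => ω u i) ∈ E i
    rw [← this]
    exact hC i
  · intro h
    exact ⟨fun i => (linialSaks T B).output G ident fun u => ω u i, h,
      fun v => output_genericLinialSaks c T B G ident ω v⟩

theorem measureReal_eq_card_div {α : Type*} [Fintype α] [MeasurableSpace α]
    [MeasurableSingletonClass α] (μ : Measure α) [IsProbabilityMeasure μ] (a : α)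
    (h : ∀ b, μ {b} = μ {a}) (E : Finset α) :
    μ.real (E : Set α) = (E.card : ℝ) / Fintype.card α := by
  have hc : ∀ E : Finset α, μ.real E = E.card * μ.real {a} := by
    intro E
    have h' : ∀ b, μ.real {b} = μ.real {a} := fun b => congrArg ENNReal.toReal (h b)
    rw [← sum_measureReal_singleton, Finset.sum_congr rfl fun b _ => h' b, Finset.sum_const,
      nsmul_eq_mul]
  have h1 := hc Finset.univ
  rw [Finset.coe_univ, probReal_univ, Finset.card_univ] at h1
  have : (Fintype.card α : ℝ) ≠ 0 := fun h0 => by simp [h0] at h1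
  rw [hc, eq_div_iff this, mul_assoc, mul_comm (μ.real _), ← h1, mul_one]

/-- The seeds of the Linial–Saks algorithm are uniformly distributed. -/
theorem law_linialSaks_real (T B : ℕ) {V : Type*} [Fintype V] [DecidableEq V]
    (E : Finset (V → Fin T → Fin B → Bool)) :
    ((linialSaks T B).law V).real (E : Set (V → Fin T → Fin B → Bool)) =
      (E.card : ℝ) / Fintype.card (V → Fin T → Fin B → Bool) := by
  refine measureReal_eq_card_div (Measure.pi fun _ : V => Measure.pi fun _ : Fin T =>
    Measure.pi fun _ : Fin B => (PMF.uniformOfFintype Bool).toMeasure) (fun _ _ _ => true)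
    (fun ω => ?_) E
  simp only [Measure.pi_singleton, PMF.toMeasure_apply_singleton _ _ (measurableSet_singleton _),
    PMF.uniformOfFintype_apply]

/-! ### Radii and tokens -/

namespace LinialSaks

theorem radius_le {B : ℕ} (coins : Fin B → Bool) : radius coins ≤ B := by
  unfold radius
  exact (Finset.card_le_univ _).trans_eq (Fintype.card_fin B)

/-- A threshold event at `j` reads only the coins of index below `j`; the flipping argument rests on
this locality. -/
theorem le_radius_iff {B : ℕ} (coins : Fin B → Bool) {j : ℕ} (hj : j ≤ B) :
    j ≤ radius coins ↔ ∀ i : Fin B, (i : ℕ) < j → coins i = true := by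
  unfold radius
  set S := Finset.univ.filter fun j : Fin B => ∀ i ≤ j, coins i = true with hS
  constructor
  · intro h
    by_contra! hne
    obtain ⟨i, hij, hi⟩ := hne
    have hsub : S ⊆ Finset.Iio i := by
      intro x hx
      rw [Finset.mem_Iio]
      by_contra! hxi
      exact hi ((Finset.mem_filter.1 hx).2 i hxi)
    have := Finset.card_le_card hsub
    rw [Fin.card_Iio] at this
    omega
  · intro h
    have hsub : (Finset.univ : Finset (Fin j)).map (Fin.castLEEmb hj) ⊆ S := by
      intro x hx
      obtain ⟨y, -, rfl⟩ := Finset.mem_map.1 hx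
      refine Finset.mem_filter.2 ⟨Finset.mem_univ _, fun i hi => h i ?_⟩
      have : (i : ℕ) ≤ y := hi
      exact this.trans_lt y.2
    have := Finset.card_le_card hsub
    simpa using this

theorem mem_multiset_sup {α : Type*} [DecidableEq α] (m : Multiset (Finset α)) (x : α) :
    x ∈ m.sup ↔ ∃ s ∈ m, x ∈ s := by
  induction m using Multiset.induction_on with
  | empty => simp
  | cons a m ih => simp [ih]

theorem mem_relay {M : Finset (ℕ × ℕ)} {p : ℕ × ℕ} : p ∈ relay M ↔ (p.1, p.2 + 1) ∈ M := by
  unfold relay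
  simp only [Finset.mem_image, Finset.mem_filter]
  constructor
  · rintro ⟨q, ⟨hq, h0⟩, rfl⟩
    have : q.2 - 1 + 1 = q.2 := by omega
    simpa [this] using hq
  · intro h
    exact ⟨_, ⟨h, by simp⟩, by simp⟩

/-! ### Single rounds of the message-passing execution -/

section Run

variable {V : Type*} [Fintype V] (G : SimpleGraph V) [DecidableRel G.Adj] (ident : V → ℕ)
  {T B : ℕ} (ω : V → Fin T → Fin B → Bool)

/-- The states of the nodes during an execution of the Linial–Saks algorithm. -/
noncomputable def states (τ : ℕ) (v : V) : NodeState T B :=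
  (linialSaks T B).run G ident ω τ v

/-- The tokens known to a node after receiving the messages of a round. -/
noncomputable def received (τ : ℕ) (v : V) : Finset (ℕ × ℕ) :=
  (states G ident ω τ v).heard ∪ (((G.neighborFinset v).val.map fun u =>
    (ident u, send (states G ident ω τ u))).map fun m => relay m.2).sup

theorem states_succ (τ : ℕ) (v : V) :
    states G ident ω (τ + 1) v = step (states G ident ω τ v) ((G.neighborFinset v).val.map fun u =>
      (ident u, send (states G ident ω τ u))) := rfl

theorem mem_received {τ : ℕ} {v : V} {p : ℕ × ℕ} :
    p ∈ received G ident ω τ v ↔ p ∈ (states G ident ω τ v).heard ∨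
      ∃ u, G.Adj v u ∧ (states G ident ω τ u).label = none ∧
        (p.1, p.2 + 1) ∈ (states G ident ω τ u).heard := by
  unfold received
  rw [Finset.mem_union, mem_multiset_sup]
  refine or_congr Iff.rfl ?_
  simp only [Multiset.mem_map, exists_exists_and_eq_and, mem_relay, Finset.mem_val,
    SimpleGraph.mem_neighborFinset]
  refine exists_congr fun u => and_congr Iff.rfl ?_
  unfold send
  split_ifs with h <;> simp [h]

theorem states_const (τ : ℕ) (v : V) :
    (states G ident ω τ v).ident = ident v ∧ (states G ident ω τ v).coins = ω v ∧
      (states G ident ω τ v).clock = τ := by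
  induction τ with
  | zero => exact ⟨rfl, rfl, rfl⟩
  | succ τ ih =>
    rw [states_succ]
    unfold step
    dsimp only
    split_ifs <;> simp [ih]

theorem states_succ_of_label_ne {τ : ℕ} {v : V} (h : (states G ident ω τ v).label ≠ none) :
    (states G ident ω (τ + 1) v).label = (states G ident ω τ v).label := by
  rw [states_succ]
  simp [step, h]

theorem states_succ_of_mod_ne {τ : ℕ} {v : V} (h : (states G ident ω τ v).label = none)
    (hτ : (τ + 1) % B ≠ 0) :
    (states G ident ω (τ + 1) v).label = none ∧
      (states G ident ω (τ + 1) v).heard = received G ident ω τ v := by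
  rw [states_succ]
  simp [step, h, (states_const G ident ω τ v).2.2, hτ, received]

theorem states_succ_of_mod_eq {τ : ℕ} {v : V} (h : (states G ident ω τ v).label = none)
    (hτ : (τ + 1) % B = 0) (hT : τ / B < T) :
    (states G ident ω (τ + 1) v).label =
        (if Joins (received G ident ω τ v) then some ⟨τ / B, hT⟩ else none) ∧
      (states G ident ω (τ + 1) v).heard = ownToken (ident v) (ω v) (τ / B + 1) := by
  have hc := states_const G ident ω τ v
  rw [states_succ]
  simp only [step, h, hc.2.2, hτ, received]
  simp [hT, hc.1, hc.2.1]

end Run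

/-! ### The abstract process behind the execution -/

section Phase

variable {V : Type*} (G : SimpleGraph V) (ident : V → ℕ)

/-- There is a walk of length `l` from `y` to `v` all of whose vertices, except possibly `v`, lie
in `A`. -/
def Reach (A : Set V) : ℕ → V → V → Prop
  | 0, y, v => y = v
  | l + 1, y, v => ∃ u, G.Adj v u ∧ u ∈ A ∧ Reach A l y u

/-- In a phase with set of unlabelled vertices `A` and radii `r`, the vertex `v` is at distance
less than the radius from the vertex with the highest ID that it hears. -/
def JoinsAt (A : Set V) (r : V → ℕ) (v : V) : Prop :=
  ∃ y l, Reach G A l y v ∧ l < r y ∧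
    ∀ z m, Reach G A m z v → m ≤ r z → ident z ≤ ident y

/-- The radii drawn in a phase. -/
def radii {T B : ℕ} (ω : V → Fin T → Fin B → Bool) (t : Fin T) (v : V) : ℕ := radius (ω v t)

/-- The vertices without a label at the start of a phase. -/
def aliveSet {T B : ℕ} (ω : V → Fin T → Fin B → Bool) : ℕ → Set V
  | 0 => Set.univ
  | t + 1 => {v ∈ aliveSet ω t | ∀ h : t < T, ¬ JoinsAt G ident (aliveSet ω t) (radii ω ⟨t, h⟩) v}

end Phase

section Tokens

variable {V : Type*} (G : SimpleGraph V) (ident : V → ℕ) {T B : ℕ} (ω : V → Fin T → Fin B → Bool)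

/-- A relayed token extends a walk by its last edge. The left side is membership in `received`
rather than in the next state, so that it also covers the last round of a phase, where `heard` is
overwritten by the next token. -/
theorem mem_heard_step {t : ℕ} (ht : t < T) {σ : V → NodeState T B} {A : Set V}
    (j : ℕ) (hA : ∀ v, (σ v).label = none ↔ v ∈ A)
    (hσ : ∀ v ∈ A, ∀ p, p ∈ (σ v).heard ↔
      ∃ y l, l ≤ j ∧ Reach G A l y v ∧ p.1 = ident y ∧ p.2 + l = radii ω ⟨t, ht⟩ y)
    {v : V} (hv : v ∈ A) (p : ℕ × ℕ) :
    (p ∈ (σ v).heard ∨ ∃ u, G.Adj v u ∧ (σ u).label = none ∧ (p.1, p.2 + 1) ∈ (σ u).heard) ↔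
      ∃ y l, l ≤ j + 1 ∧ Reach G A l y v ∧ p.1 = ident y ∧ p.2 + l = radii ω ⟨t, ht⟩ y := by
  constructor
  · rintro (h | ⟨u, huv, hu, h⟩)
    · obtain ⟨y, l, hl, h⟩ := (hσ v hv p).1 h
      exact ⟨y, l, by omega, h⟩
    · obtain ⟨y, l, hl, hr, h1, h2⟩ := (hσ u ((hA u).1 hu) _).1 h
      exact ⟨y, l + 1, by omega, ⟨u, huv, (hA u).1 hu, hr⟩, h1, by simp only at h2; omega⟩
  · rintro ⟨y, l, hl, hr, h1, h2⟩
    cases l with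
    | zero => exact Or.inl ((hσ v hv p).2 ⟨y, 0, Nat.zero_le _, hr, h1, h2⟩)
    | succ l =>
      obtain ⟨u, huv, hu, hr⟩ := hr
      exact Or.inr ⟨u, huv, (hA u).2 hu, (hσ u hu _).2 ⟨y, l, by omega, hr, h1, by
        simp only; omega⟩⟩

end Tokens

/-! ### The execution follows the abstract process -/

section Correct

variable {V : Type*} [Fintype V] (G : SimpleGraph V) [DecidableRel G.Adj] (ident : V → ℕ)
  {T B : ℕ} (ω : V → Fin T → Fin B → Bool)

/-- The relation between the states at the start of a phase and the abstract process. -/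
structure PhaseInv (t : ℕ) : Prop where
  alive : ∀ v, (states G ident ω (t * B) v).label = none ↔ v ∈ aliveSet G ident ω t
  token : ∀ v, (states G ident ω (t * B) v).label = none →
    (states G ident ω (t * B) v).heard = ownToken (ident v) (ω v) t
  joined : ∀ v s, (states G ident ω (t * B) v).label = some s →
    v ∈ aliveSet G ident ω s ∧ JoinsAt G ident (aliveSet G ident ω s) (radii ω s) v

/-- Labels change only in a round completing a multiple of `B`, so inside a phase the unlabelled set
is frozen and tokens spread one edge per round. -/
theorem PhaseInv.mid {t : ℕ} (ht : t < T) (h : PhaseInv G ident ω t) (j : ℕ) (hj : j < B) :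
    (∀ v, (states G ident ω (t * B + j) v).label = (states G ident ω (t * B) v).label) ∧
      ∀ v ∈ aliveSet G ident ω t, ∀ p, p ∈ (states G ident ω (t * B + j) v).heard ↔
        ∃ y l, l ≤ j ∧ Reach G (aliveSet G ident ω t) l y v ∧ p.1 = ident y ∧
          p.2 + l = radii ω ⟨t, ht⟩ y := by
  induction j with
  | zero =>
    refine ⟨fun v => rfl, fun v hv p => ?_⟩
    rw [Nat.add_zero, h.token v ((h.alive v).2 hv)]
    simp only [ownToken, ht, dif_pos, Finset.mem_singleton]
    constructor
    · rintro rfl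
      exact ⟨v, 0, le_rfl, rfl, rfl, rfl⟩
    · rintro ⟨y, l, hl, hr, h1, h2⟩
      obtain rfl : l = 0 := by omega
      obtain rfl : y = v := hr
      exact Prod.ext h1 h2
  | succ j ih =>
    obtain ⟨ih1, ih2⟩ := ih (by omega)
    have hmod : (t * B + j + 1) % B ≠ 0 := by
      rw [add_assoc, Nat.mul_add_mod', Nat.mod_eq_of_lt hj]
      omega
    have hA : ∀ v, (states G ident ω (t * B + j) v).label = none ↔ v ∈ aliveSet G ident ω t :=
      fun v => by rw [ih1, h.alive]
    refine ⟨fun v => ?_, fun v hv p => ?_⟩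
    · by_cases hv : (states G ident ω (t * B + j) v).label = none
      · rw [← ih1 v, hv]
        exact (states_succ_of_mod_ne G ident ω hv hmod).1
      · rw [← ih1 v]
        exact states_succ_of_label_ne G ident ω hv
    · rw [← add_assoc, (states_succ_of_mod_ne G ident ω ((hA v).2 hv) hmod).2, mem_received]
      exact mem_heard_step G ident ω ht j hA ih2 hv p

theorem PhaseInv.succ (hB : 0 < B) {t : ℕ} (ht : t < T) (h : PhaseInv G ident ω t) :
    PhaseInv G ident ω (t + 1) := by
  obtain ⟨h1, h2⟩ := h.mid G ident ω ht (B - 1) (by omega)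
  set τ := t * B + (B - 1) with hτ
  have hτ1 : (t + 1) * B = τ + 1 := by rw [add_mul]; omega
  have hmod : (τ + 1) % B = 0 := by rw [← hτ1]; exact Nat.mul_mod_left _ _
  have hdiv : τ / B = t := by
    rw [hτ, mul_comm, Nat.mul_add_div hB, Nat.div_eq_of_lt (by omega)]; omega
  have hA : ∀ v, (states G ident ω τ v).label = none ↔ v ∈ aliveSet G ident ω t :=
    fun v => by rw [h1, h.alive]
  have hJ : ∀ v ∈ aliveSet G ident ω t, Joins (received G ident ω τ v) ↔
      JoinsAt G ident (aliveSet G ident ω t) (radii ω ⟨t, ht⟩) v := by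
    intro v hv
    have hmem : ∀ p, p ∈ received G ident ω τ v ↔
        ∃ y l, Reach G (aliveSet G ident ω t) l y v ∧ p.1 = ident y ∧
          p.2 + l = radii ω ⟨t, ht⟩ y := by
      intro p
      rw [mem_received, mem_heard_step G ident ω ht (B - 1) hA h2 hv p]
      -- The length bound can be dropped: no radius exceeds `B`, so `B` rounds deliver every token
      -- as far as it can go.
      refine exists_congr fun y => exists_congr fun l => ⟨fun h => h.2, fun h => ⟨?_, h⟩⟩
      have : radii ω ⟨t, ht⟩ y ≤ B := radius_le _
      omega
    constructor
    · rintro ⟨p, hp, hmax, hpos⟩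
      obtain ⟨y, l, hr, e1, e2⟩ := (hmem p).1 hp
      refine ⟨y, l, hr, by omega, fun z m hz hm => ?_⟩
      rw [← e1]
      exact hmax (ident z, radii ω ⟨t, ht⟩ z - m) ((hmem _).2 ⟨z, m, hz, rfl, by
        simp only; omega⟩)
    · rintro ⟨y, l, hr, hl, hmax⟩
      refine ⟨(ident y, radii ω ⟨t, ht⟩ y - l), (hmem _).2 ⟨y, l, hr, rfl, by simp only; omega⟩,
        fun q hq => ?_, by simp only; omega⟩
      obtain ⟨z, m, hz, e1, e2⟩ := (hmem q).1 hq
      rw [e1]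
      exact hmax z m hz (by omega)
  have hlab : ∀ v ∈ aliveSet G ident ω t,
      ((states G ident ω (τ + 1) v).label = none ∧
        ¬ JoinsAt G ident (aliveSet G ident ω t) (radii ω ⟨t, ht⟩) v) ∨
      ((states G ident ω (τ + 1) v).label = some ⟨t, ht⟩ ∧
        JoinsAt G ident (aliveSet G ident ω t) (radii ω ⟨t, ht⟩) v) := by
    intro v hv
    have := (states_succ_of_mod_eq G ident ω ((hA v).2 hv) hmod (by rw [hdiv]; exact ht)).1
    rw [this]
    by_cases hj : Joins (received G ident ω τ v)
    · right
      rw [if_pos hj]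
      exact ⟨by simp [hdiv], (hJ v hv).1 hj⟩
    · left
      rw [if_neg hj]
      exact ⟨rfl, fun h => hj ((hJ v hv).2 h)⟩
  constructor
  · intro v
    rw [hτ1]
    by_cases hv : v ∈ aliveSet G ident ω t
    · have hiff : v ∈ aliveSet G ident ω (t + 1) ↔
          ¬ JoinsAt G ident (aliveSet G ident ω t) (radii ω ⟨t, ht⟩) v :=
        ⟨fun h => h.2 ht, fun h => ⟨hv, fun _ => h⟩⟩
      rw [hiff]
      rcases hlab v hv with ⟨e, hj⟩ | ⟨e, hj⟩ <;> simp [e, hj]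
    · have hv' := mt (hA v).1 hv
      rw [states_succ_of_label_ne G ident ω hv']
      exact ⟨fun h => absurd h hv', fun h => absurd h.1 hv⟩
  · intro v hv
    rw [hτ1] at hv ⊢
    have hv' : (states G ident ω τ v).label = none := by
      by_contra hne
      exact hne (by rw [← states_succ_of_label_ne G ident ω hne, hv])
    rw [(states_succ_of_mod_eq G ident ω hv' hmod (by rw [hdiv]; exact ht)).2, hdiv]
  · intro v s hs
    rw [hτ1] at hs
    by_cases hv : v ∈ aliveSet G ident ω t
    · rcases hlab v hv with ⟨e, hj⟩ | ⟨e, hj⟩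
      · rw [e] at hs
        cases hs
      · rw [e] at hs
        cases hs
        exact ⟨hv, hj⟩
    · rw [states_succ_of_label_ne G ident ω (mt (hA v).1 hv), h1] at hs
      exact h.joined v s hs

theorem phaseInv (hB : 0 < B) {t : ℕ} (ht : t ≤ T) : PhaseInv G ident ω t := by
  induction t with
  | zero =>
    have h0 : ∀ v, (states G ident ω (0 * B) v) = init (ident v) (ω v) := fun v => by
      rw [zero_mul]; rfl
    refine ⟨fun v => ?_, fun v _ => ?_, fun v s h => ?_⟩
    · rw [h0]
      exact ⟨fun _ => Set.mem_univ v, fun _ => rfl⟩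
    · rw [h0]
      rfl
    · rw [h0] at h
      cases h
  | succ t ih => exact (ih (by omega)).succ G ident ω hB ht

theorem output_eq_none_iff (hB : 0 < B) (v : V) :
    (linialSaks T B).output G ident ω v = none ↔ v ∈ aliveSet G ident ω T :=
  (phaseInv G ident ω hB le_rfl).alive v

theorem joinsAt_of_output_eq_some (hB : 0 < B) {v : V} {s : Fin T}
    (h : (linialSaks T B).output G ident ω v = some s) :
    v ∈ aliveSet G ident ω s ∧ JoinsAt G ident (aliveSet G ident ω s) (radii ω s) v :=
  (phaseInv G ident ω hB le_rfl).joined v s h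

end Correct

/-! ### Common leaders and weak diameter -/

section WeakDiameter

variable {V : Type*} (G : SimpleGraph V) (ident : V → ℕ)

theorem Reach.edist_le {A : Set V} {l : ℕ} {y v : V} (h : Reach G A l y v) :
    G.edist y v ≤ l := by
  induction l generalizing v with
  | zero =>
    obtain rfl : y = v := h
    simp
  | succ l ih =>
    obtain ⟨u, huv, -, hr⟩ := h
    refine (SimpleGraph.edist_triangle (v := u)).trans ?_
    push_cast
    exact add_le_add (ih hr) (SimpleGraph.edist_le_one_iff_adj_or_eq.2 (Or.inl huv.symm))

/-- `y` is the vertex with the highest ID heard by `v`, and `v` joins its cluster. -/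
def JoinsTo (A : Set V) (r : V → ℕ) (y v : V) : Prop :=
  ∃ l, Reach G A l y v ∧ l < r y ∧ ∀ z m, Reach G A m z v → m ≤ r z → ident z ≤ ident y

variable {G ident}

/-- Strictness in `l < r y` leaves one more edge, so `v` hears `y` through `u`. -/
theorem JoinsTo.ident_le {A : Set V} {r : V → ℕ} {y z u v : V} (huv : G.Adj u v) (hu : u ∈ A)
    (h : JoinsTo G ident A r y u) (h' : JoinsTo G ident A r z v) : ident y ≤ ident z := by
  obtain ⟨l, hr, hl, -⟩ := h
  obtain ⟨-, -, -, hmax⟩ := h'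
  exact hmax y (l + 1) ⟨u, huv.symm, hu, hr⟩ hl

variable (G ident)

/-- Adjacent vertices hear each other's leader, so the leader is constant along the walk. The output
of this copy is required only where `P` holds, since a selection may use other copies elsewhere. -/
theorem exists_common_leader [Fintype V] [DecidableRel G.Adj] (hid : Function.Injective ident)
    {T B : ℕ} (hB : 0 < B) (ω : V → Fin T → Fin B → Bool) (s : Fin T) {H : SimpleGraph V}
    (hH : H ≤ G) {P : V → Prop} (hP : ∀ u v, H.Adj u v → P u → P v)
    (hs : ∀ u, P u → (linialSaks T B).output G ident ω u = some s) {u v : V} (p : H.Walk u v)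
    (hu : P u) :
    ∃ y, JoinsTo G ident (aliveSet G ident ω s) (radii ω s) y u ∧
      JoinsTo G ident (aliveSet G ident ω s) (radii ω s) y v := by
  induction p with
  | nil =>
    obtain ⟨-, y, h⟩ := joinsAt_of_output_eq_some G ident ω hB (hs _ hu)
    exact ⟨y, h, h⟩
  | cons hadj p ih =>
    have hw := hP _ _ hadj hu
    obtain ⟨y, hyw, hyv⟩ := ih hw
    obtain ⟨hau, z, hz⟩ := joinsAt_of_output_eq_some G ident ω hB (hs _ hu)
    have haw := (joinsAt_of_output_eq_some G ident ω hB (hs _ hw)).1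
    have : z = y := hid (le_antisymm (JoinsTo.ident_le (hH hadj) hau hz hyw)
      (JoinsTo.ident_le (hH hadj).symm haw hyw hz))
    subst this
    exact ⟨z, hz, hyv⟩

theorem JoinsTo.edist_le {T B : ℕ} {ω : V → Fin T → Fin B → Bool} {s : Fin T} {A : Set V}
    {y u v : V} (hu : JoinsTo G ident A (radii ω s) y u) (hv : JoinsTo G ident A (radii ω s) y v) :
    G.edist u v ≤ (2 * B : ℕ) := by
  obtain ⟨l, hl, hlr, -⟩ := hu
  obtain ⟨m, hm, hmr, -⟩ := hv
  have hB : radii ω s y ≤ B := radius_le _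
  refine (SimpleGraph.edist_triangle (v := y)).trans ?_
  rw [SimpleGraph.edist_comm]
  refine (add_le_add (hl.edist_le G) (hm.edist_le G)).trans ?_
  exact_mod_cast (by omega : l + m ≤ 2 * B)

/-- Every selection from the label sets of several executions is a weak-diameter network
decomposition. -/
theorem isWeakNetworkDecomposition_of_selection [Fintype V] [DecidableRel G.Adj]
    (hid : Function.Injective ident) {c T B : ℕ} (hB : 0 < B)
    (ω : V → Fin c → Fin T → Fin B → Bool) {d K : ℕ} (hd : 2 * B ≤ d) (hK : c * T ≤ K)
    (f : V → Fin c × Fin T) (hf : ∀ v, f v ∈ (genericLinialSaks c T B).output G ident ω v) :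
    IsWeakNetworkDecomposition G d K (labelCluster G f) := by
  have hf' : ∀ v, (linialSaks T B).output G ident (fun u => ω u (f v).1) v = some (f v).2 := by
    intro v
    have h := hf v
    rw [output_genericLinialSaks] at h
    exact (Finset.mem_filter.1 h).2
  have hlab : ∀ u v, (sameLabelGraph G f).Reachable u v → f u = f v := by
    rintro u v ⟨p⟩
    induction p with
    | nil => rfl
    | cons h _ ih => exact h.2.trans ih
  constructor
  -- Each cluster is coloured by its label; adjacent clusters with equal labels would have merged.
  · let col : (sameLabelGraph G f).ConnectedComponent → Fin c × Fin T :=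
      fun C => SimpleGraph.ConnectedComponent.lift f (fun u v p _ => hlab u v ⟨p⟩) C
    have hadj : ∀ u v, G.Adj u v → labelCluster G f u ≠ labelCluster G f v → f u ≠ f v := by
      intro u v huv hne heq
      exact hne (SimpleGraph.ConnectedComponent.connectedComponentMk_eq_of_adj
        (show (sameLabelGraph G f).Adj u v from ⟨huv, heq⟩))
    have C : (clusterGraph G (labelCluster G f)).Coloring (Fin c × Fin T) := by
      refine SimpleGraph.Coloring.mk col ?_
      rintro a b ⟨hne, (⟨u, v, huv, rfl, rfl⟩ | ⟨u, v, huv, rfl, rfl⟩)⟩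
      · exact hadj u v huv hne
      · exact (hadj u v huv hne.symm).symm
    have h := C.colorable.chromaticNumber_le
    rw [Fintype.card_prod, Fintype.card_fin, Fintype.card_fin] at h
    exact h.trans (by exact_mod_cast hK)
  · intro u v huv
    obtain ⟨p⟩ := SimpleGraph.ConnectedComponent.exact huv
    obtain ⟨y, hu, hv⟩ := exists_common_leader G ident hid hB (fun w => ω w (f u).1) (f u).2
      (H := sameLabelGraph G f) (fun _ _ h => h.1) (P := fun w => f w = f u)
      (fun a b hab ha => hab.2.symm.trans ha) (fun w hw => hw ▸ hf' w) p rfl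
    exact (hu.edist_le G ident hv).trans (by exact_mod_cast hd)

end WeakDiameter

/-! ### One phase: the flipping argument -/

section SinglePhase

variable {V : Type*} [DecidableEq V] {B : ℕ}

/-- Flip the coin with index `i` of the vertex `y`. -/
def flipCoin (y : V) (i : Fin B) (x : V → Fin B → Bool) : V → Fin B → Bool :=
  Function.update x y (Function.update (x y) i (!x y i))

theorem flipCoin_flipCoin (y : V) (i : Fin B) (x : V → Fin B → Bool) :
    flipCoin y i (flipCoin y i x) = x := by
  simp [flipCoin]

theorem le_radius_flipCoin_iff {D : V → ℕ} {y : V} (hy : D y < B) (x : V → Fin B → Bool) (z : V) :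
    D z ≤ radius (flipCoin y ⟨D y, hy⟩ x z) ↔ D z ≤ radius (x z) := by
  by_cases hz : z = y
  · subst hz
    rw [le_radius_iff _ hy.le, le_radius_iff _ hy.le]
    refine forall_congr' fun i => imp_congr_right fun hi => ?_
    have : i ≠ ⟨D z, hy⟩ := fun h => by simp [h] at hi
    simp [flipCoin, this]
  · simp [flipCoin, hz]

/-- The hypotheses force the radius to equal `D y`, so the coin at index `D y` is the first tail;
the flip makes it a head. -/
theorem lt_radius_flipCoin {D : V → ℕ} {y : V} (hy : D y < B) (x : V → Fin B → Bool)
    (h : D y ≤ radius (x y)) (h' : ¬ D y < radius (x y)) :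
    D y < radius (flipCoin y ⟨D y, hy⟩ x y) := by
  rw [← Nat.succ_le_iff, le_radius_iff _ hy] at h' ⊢
  rw [le_radius_iff _ hy.le] at h
  have hf : x y ⟨D y, hy⟩ = false := by
    by_contra hne
    refine h' fun i hi => ?_
    rcases Nat.lt_succ_iff_lt_or_eq.1 hi with hi | hi
    · exact h i hi
    · obtain rfl : i = ⟨D y, hy⟩ := Fin.ext hi
      simpa using hne
  intro i hi
  rcases Nat.lt_succ_iff_lt_or_eq.1 hi with hi | hi
  · have : i ≠ ⟨D y, hy⟩ := fun h => by simp [h] at hi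
    simp [flipCoin, this, h i hi]
  · obtain rfl : i = ⟨D y, hy⟩ := Fin.ext hi
    simp [flipCoin, hf]

/-- `y` has the highest ID among the vertices whose radius is at least their distance `D`. -/
def IsLeader (ident : V → ℕ) (D : V → ℕ) (x : V → Fin B → Bool) (y : V) : Prop :=
  D y ≤ radius (x y) ∧ ∀ z, D z ≤ radius (x z) → ident z ≤ ident y

theorem IsLeader.flipCoin {ident D : V → ℕ} {x : V → Fin B → Bool} {y : V}
    (h : IsLeader ident D x y) (hy : D y < B) :
    IsLeader ident D (flipCoin y ⟨D y, hy⟩ x) y :=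
  ⟨(le_radius_flipCoin_iff hy x y).2 h.1, fun z hz => h.2 z ((le_radius_flipCoin_iff hy x z).1 hz)⟩

/-- With `2 ^ B = 2 * M`, Bernoulli gives `(1 - 1 / (2 * M)) ^ M ≥ 1 / 2`; squaring covers all
exponents up to `2 * M`. -/
theorem two_pow_sub_one_pow_le (B n : ℕ) (hB : 0 < B) (hn : n ≤ 2 ^ B) :
    (2 ^ B) ^ n ≤ 4 * (2 ^ B - 1) ^ n := by
  obtain ⟨b, rfl⟩ : ∃ b, B = b + 1 := ⟨B - 1, by omega⟩
  set M := 2 ^ b with hM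
  have hM1 : 1 ≤ M := Nat.one_le_two_pow
  have hN : 2 ^ (b + 1) = 2 * M := by rw [pow_succ, mul_comm]
  rw [hN] at hn ⊢
  have hMr : (1 : ℝ) ≤ M := by exact_mod_cast hM1
  have hx0 : (0 : ℝ) ≤ 1 - 1 / (2 * M) := by
    rw [sub_nonneg, div_le_one (by positivity)]; linarith
  have hx1 : (1 : ℝ) - 1 / (2 * M) ≤ 1 := by
    have : (0 : ℝ) ≤ 1 / (2 * M) := by positivity
    linarith
  have h1 : (1 : ℝ) / 2 ≤ (1 - 1 / (2 * M)) ^ M := by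
    have := one_add_mul_le_pow (a := -(1 / (2 * (M : ℝ)))) (by linarith) M
    rw [← sub_eq_add_neg] at this
    refine le_trans (le_of_eq ?_) this
    field_simp
    ring
  have h2 : (1 : ℝ) / 4 ≤ (1 - 1 / (2 * M)) ^ n := by
    refine le_trans ?_ (pow_le_pow_of_le_one hx0 hx1 hn)
    rw [pow_mul', sq]
    nlinarith
  have h3 : ((2 * M - 1 : ℕ) : ℝ) = (2 * M) * (1 - 1 / (2 * M)) := by
    rw [Nat.cast_sub (by omega)]
    push_cast
    field_simp
  have h4 : ((2 * M : ℕ) : ℝ) ^ n ≤ 4 * ((2 * M - 1 : ℕ) : ℝ) ^ n := by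
    rw [h3, mul_pow]
    push_cast
    have : (0 : ℝ) ≤ (2 * M) ^ n := by positivity
    nlinarith
  exact_mod_cast h4

variable [Fintype V]

open Classical in
/-- For at least one eighth of the coin sequences the leader is at distance less than its radius. -/
theorem card_le_card_leader {ident : V → ℕ} (hid : Function.Injective ident) (hB : 0 < B)
    (hV : Fintype.card V ≤ 2 ^ B) (D : V → ℕ) {v : V} (hv : D v = 0) :
    Fintype.card (V → Fin B → Bool) ≤ 8 * (Finset.univ.filter fun x : V → Fin B → Bool =>
      ∃ y, IsLeader ident D x y ∧ D y < radius (x y)).card := by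
  set J := Finset.univ.filter fun x : V → Fin B → Bool =>
      ∃ y, IsLeader ident D x y ∧ D y < radius (x y) with hJ
  -- `N` forbids the maximal radius `B` to vertices at distance at least `B`, so that the leader
  -- always has a coin at index `D y` to flip.
  let N : Finset (V → Fin B → Bool) := Fintype.piFinset fun y =>
    if B ≤ D y then Finset.univ.erase fun _ => true else Finset.univ
  have hN : (2 ^ B - 1) ^ Fintype.card V ≤ N.card := by
    rw [Fintype.card_piFinset, ← Finset.card_univ (α := V)]
    refine Finset.pow_card_le_prod Finset.univ (fun y : V => ((if B ≤ D y then
      Finset.univ.erase fun _ => true else Finset.univ : Finset (Fin B → Bool)).card)) _ ?_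
    intro y _
    split_ifs
    · simp [Finset.card_erase_of_mem]
    · simp
  have hlead : ∀ x ∈ N, ∃ y, IsLeader ident D x y ∧ D y < B := by
    intro x hx
    obtain ⟨y, hy, hmax⟩ := Finset.exists_max_image
      (Finset.univ.filter fun y => D y ≤ radius (x y)) ident ⟨v, by simp [hv]⟩
    rw [Finset.mem_filter] at hy
    refine ⟨y, ⟨hy.2, fun z hz => hmax z (by simpa using hz)⟩, ?_⟩
    by_contra! hyB
    have hr := radius_le (x y)
    have h1 := (le_radius_iff (x y) le_rfl).1 (hyB.trans hy.2)
    have h2 := Fintype.mem_piFinset.1 hx y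
    rw [if_pos hyB] at h2
    exact (Finset.mem_erase.1 h2).1 (funext fun i => h1 i i.2)
  have : Nonempty V := ⟨v⟩
  choose! ℓ hℓ hℓB using hlead
  have hcard : (N \ J).card ≤ J.card := by
    let φ : (V → Fin B → Bool) → V → Fin B → Bool := fun x =>
      if h : D (ℓ x) < B then flipCoin (ℓ x) ⟨D (ℓ x), h⟩ x else x
    have hφ : ∀ x (hx : x ∈ N), φ x = flipCoin (ℓ x) ⟨D (ℓ x), hℓB x hx⟩ x :=
      fun x hx => dif_pos (hℓB x hx)
    refine Finset.card_le_card_of_injOn φ ?_ ?_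
    · intro x hx
      obtain ⟨hxN, hxJ⟩ := Finset.mem_sdiff.1 hx
      refine Finset.mem_filter.2 ⟨Finset.mem_univ _, ℓ x, ?_⟩
      rw [hφ x hxN]
      refine ⟨(hℓ x hxN).flipCoin _, lt_radius_flipCoin _ _ (hℓ x hxN).1 fun h => hxJ ?_⟩
      exact Finset.mem_filter.2 ⟨Finset.mem_univ _, ℓ x, hℓ x hxN, h⟩
    · intro x hx x' hx' heq
      have hxN := (Finset.mem_sdiff.1 hx).1
      have hxN' := (Finset.mem_sdiff.1 hx').1
      rw [hφ x hxN, hφ x' hxN'] at heq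
      -- The leader survives the flip, so it can be read off the image; this identifies the flipped
      -- coin, and flipping again recovers `x`.
      have h1 := (hℓ x hxN).flipCoin (hℓB x hxN)
      have h2 := (hℓ x' hxN').flipCoin (hℓB x' hxN')
      rw [← heq] at h2
      have e : ℓ x = ℓ x' := hid (le_antisymm (h2.2 _ h1.1) (h1.2 _ h2.1))
      have e' : (⟨D (ℓ x'), hℓB x' hxN'⟩ : Fin B) = ⟨D (ℓ x), hℓB x hxN⟩ := by
        simp [e]
      rw [e', ← e] at heq
      rw [← flipCoin_flipCoin (ℓ x) ⟨D (ℓ x), hℓB x hxN⟩ x, heq, flipCoin_flipCoin]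
  have h1 : N.card ≤ 2 * J.card := by
    have := Finset.card_le_card_sdiff_add_card (s := N) (t := J)
    omega
  have h2 := two_pow_sub_one_pow_le B (Fintype.card V) hB hV
  have h3 : Fintype.card (V → Fin B → Bool) = (2 ^ B) ^ Fintype.card V := by simp
  omega

variable (G : SimpleGraph V) (ident : V → ℕ)

open Classical in
theorem card_not_joinsAt_le (hid : Function.Injective ident) (hB : 0 < B)
    (hV : Fintype.card V ≤ 2 ^ B) (A : Set V) (v : V) :
    8 * (Finset.univ.filter fun x : V → Fin B → Bool =>
      ¬ JoinsAt G ident A (fun y => radius (x y)) v).card ≤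
      7 * Fintype.card (V → Fin B → Bool) := by
  -- The default `B + 1` exceeds every radius, so unreachable vertices never compete for leadership.
  let D : V → ℕ := fun y => if h : ∃ l, Reach G A l y v then Nat.find h else B + 1
  have hD : ∀ y l, Reach G A l y v → D y ≤ l := fun y l h => by
    have h' : ∃ l, Reach G A l y v := ⟨l, h⟩
    simp only [D, dif_pos h']
    exact Nat.find_min' h' h
  have hD' : ∀ y, D y ≤ B → Reach G A (D y) y v := fun y h => by
    by_cases h' : ∃ l, Reach G A l y v
    · simp only [D, dif_pos h']
      exact Nat.find_spec h'
    · simp only [D, dif_neg h'] at h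
      omega
  have hsub : (Finset.univ.filter fun x : V → Fin B → Bool =>
      ∃ y, IsLeader ident D x y ∧ D y < radius (x y)) ⊆ Finset.univ.filter fun x =>
        JoinsAt G ident A (fun y => radius (x y)) v := by
    refine Finset.monotone_filter_right _ ?_
    rintro x - ⟨y, ⟨-, hmax⟩, hlt⟩
    exact ⟨y, D y, hD' y (hlt.le.trans (radius_le _)), hlt,
      fun z m hz hm => hmax z ((hD z m hz).trans hm)⟩
  have h1 := card_le_card_leader hid hB hV D (v := v) (Nat.le_zero.1 (hD v 0 rfl))
  have h2 := Finset.card_le_card hsub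
  have h3 := Finset.card_filter_add_card_filter_not (s := Finset.univ)
    fun x : V → Fin B → Bool => JoinsAt G ident A (fun y => radius (x y)) v
  rw [Finset.card_univ] at h3
  omega

end SinglePhase

/-! ### Iterating over the phases -/

section AllPhases

variable {V : Type*} (G : SimpleGraph V) (ident : V → ℕ) {T B : ℕ}

/-- Replace the coins of phase `t` by `x`. -/
def replaceCoins (t : Fin T) (x : V → Fin B → Bool) (ω : V → Fin T → Fin B → Bool) :
    V → Fin T → Fin B → Bool :=
  fun v => Function.update (ω v) t (x v)

/-- The unlabelled set at the start of phase `s` reads only the coins of earlier phases. -/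
theorem aliveSet_replaceCoins (t : Fin T) (x : V → Fin B → Bool)
    (ω : V → Fin T → Fin B → Bool) {s : ℕ} (hs : s ≤ t) :
    aliveSet G ident (replaceCoins t x ω) s = aliveSet G ident ω s := by
  induction s with
  | zero => rfl
  | succ s ih =>
    have hr : ∀ h : s < T, radii (replaceCoins t x ω) ⟨s, h⟩ = radii ω ⟨s, h⟩ := by
      intro h
      funext v
      have : (⟨s, h⟩ : Fin T) ≠ t := fun e => by
        have := congrArg Fin.val e
        simp only at this
        omega
      simp [radii, replaceCoins, this]
    simp only [aliveSet, ih (by omega), hr]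

variable [Fintype V] [DecidableEq V]

-- Independence by resampling: exchanging the coins of phase `t` with fresh ones `x` is injective,
-- fixes the unlabelled set before phase `t`, and leaves the old coins as a failing sample for it.
-- So the one-phase bound applies fibrewise.
open Classical in
theorem card_aliveSet_succ_le (hid : Function.Injective ident) (hB : 0 < B)
    (hV : Fintype.card V ≤ 2 ^ B) (v : V) {t : ℕ} (ht : t < T) :
    8 * (Finset.univ.filter fun ω : V → Fin T → Fin B → Bool =>
        v ∈ aliveSet G ident ω (t + 1)).card ≤
      7 * (Finset.univ.filter fun ω : V → Fin T → Fin B → Bool =>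
        v ∈ aliveSet G ident ω t).card := by
  set M' := Finset.univ.filter fun ω : V → Fin T → Fin B → Bool => v ∈ aliveSet G ident ω (t + 1)
  set M := Finset.univ.filter fun ω : V → Fin T → Fin B → Bool => v ∈ aliveSet G ident ω t
  let S : Finset (Σ _ : V → Fin T → Fin B → Bool, V → Fin B → Bool) := M.sigma fun ω =>
    Finset.univ.filter fun x => ¬ JoinsAt G ident (aliveSet G ident ω t) (fun y => radius (x y)) v
  have h1 : M'.card * Fintype.card (V → Fin B → Bool) ≤ S.card := by
    rw [← Finset.card_univ, ← Finset.card_product]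
    refine Finset.card_le_card_of_injOn
      (fun p => ⟨replaceCoins ⟨t, ht⟩ p.2 p.1, fun u => p.1 u ⟨t, ht⟩⟩) ?_ ?_
    · rintro ⟨ω, x⟩ h
      have hω : v ∈ aliveSet G ident ω (t + 1) :=
        (Finset.mem_filter.1 (Finset.mem_product.1 h).1).2
      have ha := aliveSet_replaceCoins G ident ⟨t, ht⟩ x ω (s := t) le_rfl
      refine Finset.mem_sigma.2 ⟨Finset.mem_filter.2 ⟨Finset.mem_univ _, ?_⟩,
        Finset.mem_filter.2 ⟨Finset.mem_univ _, ?_⟩⟩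
      · change v ∈ aliveSet G ident (replaceCoins ⟨t, ht⟩ x ω) t
        rw [ha]
        exact hω.1
      · change ¬ JoinsAt G ident (aliveSet G ident (replaceCoins ⟨t, ht⟩ x ω) t)
          (radii ω ⟨t, ht⟩) v
        rw [ha]
        exact hω.2 ht
    · rintro ⟨ω, x⟩ - ⟨ω', x'⟩ - h
      simp only [Sigma.mk.injEq, heq_eq_eq] at h
      obtain ⟨h, h'⟩ := h
      refine Prod.ext ?_ ?_
      · funext u s
        by_cases hs : s = ⟨t, ht⟩
        · subst hs
          exact congrFun h' u
        · simpa [replaceCoins, hs] using congrFun (congrFun h u) s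
      · funext u
        simpa [replaceCoins] using congrFun (congrFun h u) ⟨t, ht⟩
  have h2 : 8 * S.card ≤ 7 * M.card * Fintype.card (V → Fin B → Bool) := by
    rw [Finset.card_sigma, Finset.mul_sum]
    refine (Finset.sum_le_card_nsmul _ _ _ fun ω _ =>
      card_not_joinsAt_le G ident hid hB hV (aliveSet G ident ω t) v).trans_eq ?_
    rw [smul_eq_mul]
    ring
  have h3 : 0 < Fintype.card (V → Fin B → Bool) := Fintype.card_pos
  refine Nat.le_of_mul_le_mul_right ?_ h3
  calc 8 * M'.card * Fintype.card (V → Fin B → Bool)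
      = 8 * (M'.card * Fintype.card (V → Fin B → Bool)) := by ring
    _ ≤ 8 * S.card := by gcongr
    _ ≤ _ := h2

open Classical in
theorem card_aliveSet_le (hid : Function.Injective ident) (hB : 0 < B)
    (hV : Fintype.card V ≤ 2 ^ B) (v : V) {t : ℕ} (ht : t ≤ T) :
    ((Finset.univ.filter fun ω : V → Fin T → Fin B → Bool =>
        v ∈ aliveSet G ident ω t).card : ℝ) ≤
      (7 / 8) ^ t * Fintype.card (V → Fin T → Fin B → Bool) := by
  induction t with
  | zero =>
    rw [pow_zero, one_mul]
    exact_mod_cast Finset.card_le_univ _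
  | succ t ih =>
    have h := (Nat.cast_le (α := ℝ)).2 (card_aliveSet_succ_le G ident hid hB hV v ht)
    push_cast at h
    have ih := ih (by omega)
    rw [pow_succ]
    linarith

open Classical in
/-- With high probability, every vertex gets a label. -/
theorem law_output_isSome [DecidableRel G.Adj] (hid : Function.Injective ident) (hB : 0 < B)
    (hV : Fintype.card V ≤ 2 ^ B) :
    1 - Fintype.card V * (7 / 8 : ℝ) ^ T ≤ ((linialSaks T B).law V).real
      {ω | ∀ v, (linialSaks T B).output G ident ω v ≠ none} := by
  set Ω := Fintype.card (V → Fin T → Fin B → Bool) with hΩ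
  have hpos : 0 < (Ω : ℝ) := by exact_mod_cast Fintype.card_pos
  let bad := Finset.univ.filter fun ω : V → Fin T → Fin B → Bool =>
    ∃ v, v ∈ aliveSet G ident ω T
  have hbad : (bad.card : ℝ) ≤ Fintype.card V * (7 / 8 : ℝ) ^ T * Ω := by
    have hsub : bad ⊆ Finset.univ.biUnion fun v => Finset.univ.filter
        fun ω : V → Fin T → Fin B → Bool => v ∈ aliveSet G ident ω T := by
      intro ω h
      obtain ⟨v, hv⟩ := (Finset.mem_filter.1 h).2
      exact Finset.mem_biUnion.2 ⟨v, Finset.mem_univ _, Finset.mem_filter.2 ⟨Finset.mem_univ _, hv⟩⟩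
    have h1 : (bad.card : ℝ) ≤ ∑ v, ((Finset.univ.filter
        fun ω : V → Fin T → Fin B → Bool => v ∈ aliveSet G ident ω T).card : ℝ) := by
      exact_mod_cast (Finset.card_le_card hsub).trans Finset.card_biUnion_le
    refine h1.trans ((Finset.sum_le_card_nsmul _ _ _ fun v _ =>
      card_aliveSet_le G ident hid hB hV v le_rfl).trans_eq ?_)
    rw [Finset.card_univ, nsmul_eq_mul, mul_assoc]
  have hset : {ω : V → Fin T → Fin B → Bool |
      ∀ v, (linialSaks T B).output G ident ω v ≠ none} = ((badᶜ : Finset _) : Set _) := by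
    ext ω
    simp [bad, output_eq_none_iff G ident ω hB]
  have hcard : (badᶜ.card : ℝ) = Ω - bad.card := by
    rw [Finset.card_compl, Nat.cast_sub (Finset.card_le_univ _)]
  refine le_of_le_of_eq ?_ (congrArg _ hset).symm
  rw [law_linialSaks_real, hcard, le_div_iff₀ hpos]
  linarith

end AllPhases

/-! ### Numerical estimates -/

theorem clog_le_four_mul_log {n : ℕ} (hn : 2 ≤ n) : (Nat.clog 2 n : ℝ) ≤ 4 * Real.log n := by
  have h1 := Nat.pow_pred_clog_lt_self one_lt_two (show 1 < n by omega)
  have hpos : 0 < Nat.clog 2 n := Nat.clog_pos one_lt_two hn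
  set b := Nat.clog 2 n
  have h2 : (b.pred : ℝ) * Real.log 2 ≤ Real.log n := by
    rw [← Real.log_pow]
    exact Real.log_le_log (by positivity) (by exact_mod_cast h1.le)
  have h3 : Real.log 2 ≤ Real.log n := Real.log_le_log two_pos (by exact_mod_cast hn)
  have h4 := Real.log_two_gt_d9
  have h5 : (b : ℝ) = b.pred + 1 := by
    exact_mod_cast (Nat.succ_pred_eq_of_pos hpos).symm
  have h6 : (0 : ℝ) ≤ b.pred := by positivity
  nlinarith

/-- Since `(7/8)^6 < 1/2`, each block of `6 * Nat.clog 2 n` phases gains a factor `1 / n`; of the `k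
+ 1` blocks one pays for the union bound. -/
theorem card_mul_seven_eighths_pow_le {n k : ℕ} (hn : 2 ≤ n) :
    (n : ℝ) * (7 / 8 : ℝ) ^ (6 * (k + 1) * Nat.clog 2 n) ≤ 1 / (n : ℝ) ^ k := by
  have hn0 : (0 : ℝ) < n := by exact_mod_cast (by omega : 0 < n)
  have h1 : (n : ℝ) ≤ 2 ^ Nat.clog 2 n := by exact_mod_cast Nat.le_pow_clog one_lt_two n
  have h2 : (7 / 8 : ℝ) ^ (6 * (k + 1) * Nat.clog 2 n) ≤ (1 / n) ^ (k + 1) := by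
    rw [mul_assoc, mul_comm (k + 1), pow_mul, pow_mul]
    refine pow_le_pow_left₀ (by positivity) ?_ _
    calc ((7 / 8 : ℝ) ^ 6) ^ Nat.clog 2 n ≤ (1 / 2) ^ Nat.clog 2 n :=
          pow_le_pow_left₀ (by positivity) (by norm_num) _
      _ = 1 / 2 ^ Nat.clog 2 n := by rw [div_pow, one_pow]
      _ ≤ 1 / n := one_div_le_one_div_of_le hn0 h1
  refine (mul_le_mul_of_nonneg_left h2 hn0.le).trans_eq ?_
  rw [pow_succ, one_div_pow]
  field_simp

end LinialSaks

/-! ### Assembly -/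

theorem card_tagged {c T : ℕ} {C : Fin c → Option (Fin T)} (h : ∀ i, C i ≠ none) :
    (tagged C).card = c := by
  choose s hs using fun i => Option.ne_none_iff_exists'.1 (h i)
  have : tagged C = Finset.univ.image fun i => (i, s i) := by
    ext ⟨i, j⟩
    simp [tagged, hs]
  rw [this, Finset.card_image_of_injective _ fun i j h => congrArg Prod.fst h, Finset.card_univ,
    Fintype.card_fin]

theorem mainTheorem7 :
    ∀ k : ℕ, ∃ (a : ℕ) (K : ℝ), 0 < K ∧
      ∀ (V : Type*) [Fintype V] (G : SimpleGraph V) [DecidableRel G.Adj]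
        (ident : V → ℕ) (n c T B : ℕ),
        Function.Injective ident → Fintype.card V = n → 2 ≤ n → 1 ≤ c →
        T = a * Nat.clog 2 n → B = Nat.clog 2 n →
          -- the number of rounds
          ((genericLinialSaks c T B).rounds : ℝ) ≤ K * Real.log n ^ 2 ∧
          -- the size of the problem domain
          (Fintype.card (Fin c × Fin T) : ℝ) ≤ K * (c * Real.log n) ∧
          -- the tagged labels come from `c` independent executions of the Linial–Saks algorithm
          (∀ E : Fin c → Set (V → Option (Fin T)),
            (genericLinialSaks c T B).law V
                {ω | ∃ C : Fin c → V → Option (Fin T), (∀ i, C i ∈ E i) ∧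
                  ∀ v, (genericLinialSaks c T B).output G ident ω v = tagged fun i => C i v} =
              ∏ i, (linialSaks T B).law V {ω | (linialSaks T B).output G ident ω ∈ E i}) ∧
          -- the outcome
          (1 - 1 / (n : ℝ) ^ k) ^ c ≤ ((genericLinialSaks c T B).law V).real
            {ω | let S : V → Finset (Fin c × Fin T) := (genericLinialSaks c T B).output G ident ω
              (∀ v, (S v).card = c) ∧
              IsGenericSolution (fun f => IsWeakNetworkDecomposition G
                ⌊K * Real.log n⌋₊ ⌊K * (c * Real.log n)⌋₊ (labelCluster G f)) S ∧
              solutionDomainSize S = c ∧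
              contingencyFactor S ≤ K * Real.log n} := by
  intro k
  -- The factor 16 is the square of the 4 in `B ≤ 4 * log n`, as needed for the `T * B` rounds; the
  -- other bounds have slack.
  refine ⟨6 * (k + 1), 16 * (6 * (k + 1)), by positivity, ?_⟩
  intro V _ G _ ident n c T B hid hn hn2 hc hT hB
  have hB0 : 0 < B := hB ▸ Nat.clog_pos one_lt_two hn2
  have hBlog : (B : ℝ) ≤ 4 * Real.log n := hB ▸ LinialSaks.clog_le_four_mul_log hn2
  have hV : Fintype.card V ≤ 2 ^ B := by
    rw [hn, hB]
    exact Nat.le_pow_clog one_lt_two n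
  have hlog : 0 ≤ Real.log n := Real.log_natCast_nonneg n
  have hk : (1 : ℝ) ≤ k + 1 := by
    have : (0 : ℝ) ≤ k := Nat.cast_nonneg k
    linarith
  have hTB : (T : ℝ) = 6 * (k + 1) * B := by
    rw [hT, hB]
    push_cast
    ring
  have hTlog : (T : ℝ) ≤ 16 * (6 * (k + 1)) * Real.log n := by
    rw [hTB]
    have : (0 : ℝ) ≤ (k + 1) * Real.log n := by positivity
    nlinarith
  have hcT : (c : ℝ) * T ≤ 16 * (6 * (k + 1)) * (c * Real.log n) := by
    have := mul_le_mul_of_nonneg_left hTlog (Nat.cast_nonneg c)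
    linarith
  refine ⟨?_, ?_, law_genericLinialSaks_output c T B G ident, ?_⟩
  · change ((T * B : ℕ) : ℝ) ≤ _
    push_cast
    rw [hTB]
    have h : (B : ℝ) * B ≤ (4 * Real.log n) * (4 * Real.log n) :=
      mul_le_mul hBlog hBlog (Nat.cast_nonneg B) (by positivity)
    have := mul_le_mul_of_nonneg_left h (by positivity : (0 : ℝ) ≤ 6 * (k + 1))
    linarith
  · rw [Fintype.card_prod, Fintype.card_fin, Fintype.card_fin]
    push_cast
    exact hcT
  · classical
    have : IsProbabilityMeasure ((genericLinialSaks c T B).law V) := by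
      unfold LocalAlgorithm.law
      infer_instance
    have : Nonempty V := Fintype.card_pos_iff.1 (by omega)
    have hp : 1 - 1 / (n : ℝ) ^ k ≤ ((linialSaks T B).law V).real
        {ω | ∀ v, (linialSaks T B).output G ident ω v ≠ none} := by
      refine le_trans ?_ (LinialSaks.law_output_isSome G ident hid hB0 hV)
      rw [hn, hT]
      have := LinialSaks.card_mul_seven_eighths_pow_le (k := k) hn2
      linarith
    have hp0 : 0 ≤ 1 - 1 / (n : ℝ) ^ k := by
      rw [sub_nonneg]
      exact div_le_one_of_le₀ (one_le_pow₀ (by exact_mod_cast (by omega : 1 ≤ n))) (by positivity)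
    have hprod := congrArg ENNReal.toReal (law_genericLinialSaks_slices c T B (V := V) fun _ =>
      {ω | ∀ v, (linialSaks T B).output G ident ω v ≠ none})
    rw [Finset.prod_const, Finset.card_univ, Fintype.card_fin, ENNReal.toReal_pow] at hprod
    -- It remains to see that the outcome holds surely once every copy labels every vertex.
    refine (pow_le_pow_left₀ hp0 hp c).trans (hprod.symm.le.trans (measureReal_mono ?_))
    intro ω hω
    have hcard : ∀ v, ((genericLinialSaks c T B).output G ident ω v).card = c := fun v =>
      (congrArg Finset.card (output_genericLinialSaks c T B G ident ω v)).trans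
        (card_tagged fun i => hω i v)
    have hsize : solutionDomainSize ((genericLinialSaks c T B).output G ident ω) = c := by
      unfold solutionDomainSize
      simp only [hcard, ciInf_const]
    refine ⟨hcard, ⟨fun v => ?_, fun f hf => ?_⟩, hsize, ?_⟩
    · rw [← Finset.card_pos, hcard]
      exact hc
    · refine LinialSaks.isWeakNetworkDecomposition_of_selection G ident hid hB0 ω (Nat.le_floor ?_)
        (Nat.le_floor ?_) f hf
      · push_cast
        have : (0 : ℝ) ≤ k * Real.log n := by positivity
        linarith
      · push_cast
        exact hcT
    · unfold contingencyFactor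
      rw [hsize, Fintype.card_prod, Fintype.card_fin, Fintype.card_fin]
      push_cast
      have hc0 : (c : ℝ) ≠ 0 := by exact_mod_cast (by omega : c ≠ 0)
      rw [mul_div_cancel_left₀ _ hc0]
      exact hTlog
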